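/- Let $\mathcal B$ be a separable complex Banach space and let $A_1,\dots,A_p$, $B_0,\dots,B_q$ be continuous linear operators on $\mathcal B$ such that $Q(z)=z^p\,\mathrm{id}-z^{p-1}A_1-\cdots-zA_{p-1}-A_p$ is invertible for all $z\in\mathbb C$ with $|z|=1$. For $\mathcal B$-valued random variables $X,Y$ with $\mathbb E\|X\|^2,\mathbb E\|Y\|^2<\infty$, the cross covariance operator is $C_{X,Y}(x^*)=\mathbb E\big[\overline{x^*(X-\mathbb EX)}\,(Y-\mathbb EY)\big]$, $x^*\in\mathcal B^*$, and $C_X=C_{X,X}$ is the covariance operator. A process $(Y_t)_{t\in\mathbb Z}$ is weakly stationary if $\mathbb E\|Y_t\|^2<\infty$ for all $t$, $\mathbb EY_t$ does not depend on $t$, and $C_{Y_{s+h},Y_{t+h}}=C_{Y_s,Y_t}$ for all $s,t,h\in\mathbb Z$. Let $(Z_t)_{t\in\mathbb Z}$ be weak white noise in $\mathcal B$, i.e. $\mathbb E\|Z_t\|^2<\infty$ for all $t$, $\mathbb EZ_t$ and $C_{Z_t}$ do not depend on $t$, and $C_{Z_s,Z_t}=0$ for $s\ne t$. Assume that $\mathbb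 E[Z_0]=0$ and $\sup_{t}\mathbb E\|Z_t\|^2<\infty$ (for instance, that $\mathbb E\|Z_t\|^2$ does not depend on $t$). Then the function $(\mathrm{id}-zA_1-\cdots-z^pA_p)^{-1}(B_0+zB_1+\cdots+z^qB_q)$ is defined on an open annulus containing the unit circle and is there the sum of its Laurent series $\sum_{k\in\mathbb Z}z^k\psi_k$, with $$\psi_n=\frac1{2\pi i}\int_{|z|=1}z^{-n-1}(\mathrm{id}-zA_1-\cdots-z^pA_p)^{-1}(B_0+zB_1+\cdots+z^qB_q)\,dz,\qquad n\in\mathbb Z,$$ and the ARMA($p$,$q$) equation $$Y_t-A_1Y_{t-1}-\cdots-A_pY_{t-p}=B_0Z_t+\cdots+B_qZ_{t-q}\quad\text{a.s.},\qquad t\in\mathbb Z,$$ has a weakly stationary solution $(Y_t)_{t\in\mathbb Z}$, which is unique up to almost sure equality at each $t$ and is given by $$Y_t=\sum_{k=-\infty}^{\infty}\psi_kZ_{t-k},$$ where for every $t$ the series converges almost surely absolutely and in $L^2$. -/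

import Mathlib

open MeasureTheory Filter Topology

noncomputable section

section Operators

variable {E : Type*} [NormedAddCommGroup E] [NormedSpace ℂ E]

/-- The operator polynomial `Q(z) = z^p id - z^(p-1) A₁ - ⋯ - z A_(p-1) - A_p`. Only the values
`A 1, …, A p` of the family `A` are used. -/
def armaQ (p : ℕ) (A : ℕ → E →L[ℂ] E) (z : ℂ) : E →L[ℂ] E :=
  z ^ p • (1 : E →L[ℂ] E) - ∑ i ∈ Finset.Icc 1 p, z ^ (p - i) • A i

/-- The autoregressive polynomial `id - z A₁ - ⋯ - z^p A_p`. -/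
def arPoly (p : ℕ) (A : ℕ → E →L[ℂ] E) (z : ℂ) : E →L[ℂ] E :=
  1 - ∑ i ∈ Finset.Icc 1 p, z ^ i • A i

/-- The moving average polynomial `B₀ + z B₁ + ⋯ + z^q B_q`. -/
def maPoly (q : ℕ) (B : ℕ → E →L[ℂ] E) (z : ℂ) : E →L[ℂ] E :=
  ∑ k ∈ Finset.range (q + 1), z ^ k • B k

/-- The transfer function `(id - z A₁ - ⋯ - z^p A_p)⁻¹ (B₀ + z B₁ + ⋯ + z^q B_q)`. -/
def armaTransfer (p q : ℕ) (A B : ℕ → E →L[ℂ] E) (z : ℂ) : E →L[ℂ] E :=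
  Ring.inverse (arPoly p A z) * maPoly q B z

/-- `ψ_n = (2πi)⁻¹ ∮ z^(-n-1) (id - z A₁ - ⋯ - z^p A_p)⁻¹ (B₀ + ⋯ + z^q B_q) dz`, the integral being
over the unit circle: the `n`-th Laurent coefficient of the transfer function. -/
def armaCoeff (p q : ℕ) (A B : ℕ → E →L[ℂ] E) (n : ℤ) : E →L[ℂ] E :=
  (2 * Real.pi * Complex.I : ℂ)⁻¹ • ∮ z in C(0, 1), z ^ (-n - 1) • armaTransfer p q A B z

/-- `Y` solves the ARMA(p,q) equation
`Y_t - A₁ Y_(t-1) - ⋯ - A_p Y_(t-p) = B₀ Z_t + ⋯ + B_q Z_(t-q)` (almost surely, for every `t`). -/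
def IsARMASolution {Ω : Type*} [MeasurableSpace Ω] (P : Measure Ω) (p q : ℕ)
    (A B : ℕ → E →L[ℂ] E) (Z Y : ℤ → Ω → E) : Prop :=
  ∀ t : ℤ, ∀ᵐ ω ∂P,
    Y t ω - ∑ i ∈ Finset.Icc 1 p, A i (Y (t - i) ω)
      = ∑ k ∈ Finset.range (q + 1), B k (Z (t - k) ω)

end Operators

section Processes

variable {E : Type*} [NormedAddCommGroup E] [NormedSpace ℂ E]
  {Ω : Type*} [MeasurableSpace Ω]

/-- The cross covariance operator of two second order random variables with values in a complex
Banach space: `f ↦ 𝔼[conj (f (X - 𝔼 X)) (Y - 𝔼 Y)]`, a (conjugate linear) map from the dual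
space into the space. The covariance operator of `X` is the case `Y = X`. -/
def crossCovOp (P : Measure Ω) (X Y : Ω → E) (f : StrongDual ℂ E) : E :=
  ∫ ω, (starRingEnd ℂ) (f (X ω - ∫ ω', X ω' ∂P)) • (Y ω - ∫ ω', Y ω' ∂P) ∂P

variable [MeasurableSpace E]

/-- Weak white noise: second order random variables with constant expectation, constant
covariance operator and vanishing cross covariance operators. -/
structure IsWeakWhiteNoise (P : Measure Ω) (Z : ℤ → Ω → E) : Prop where
  measurable : ∀ t, Measurable (Z t)
  memLp_two : ∀ t, MemLp (Z t) 2 P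
  mean_eq : ∀ s t, ∫ ω, Z s ω ∂P = ∫ ω, Z t ω ∂P
  cov_eq : ∀ s t, crossCovOp P (Z s) (Z s) = crossCovOp P (Z t) (Z t)
  crossCov_eq_zero : ∀ s t, s ≠ t → crossCovOp P (Z s) (Z t) = 0

/-- Weak stationarity: second order random variables with constant expectation, whose cross
covariance operators are invariant under time shifts. -/
structure IsWeaklyStationary (P : Measure Ω) (Y : ℤ → Ω → E) : Prop where
  measurable : ∀ t, Measurable (Y t)
  memLp_two : ∀ t, MemLp (Y t) 2 P
  mean_eq : ∀ s t, ∫ ω, Y s ω ∂P = ∫ ω, Y t ω ∂P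
  crossCov_shift : ∀ s t h, crossCovOp P (Y (s + h)) (Y (t + h)) = crossCovOp P (Y s) (Y t)

end Processes

end

/-! ### Vector-valued Laurent expansion on an annulus around the unit circle -/

section Laurent

variable {V : Type*} [NormedAddCommGroup V] [NormedSpace ℂ V]

/-! On the unit circle the autoregressive polynomial equals `z ^ p • Q(1/z)`, hence is invertible
there and, units being open and the circle compact, on an open annulus. The transfer function is
holomorphic on that annulus, so `hasSum_laurent` expands it, and its coefficients decay
geometrically in both directions (`summable_norm_laurentCoeff`).

Existence: since `‖ψ_k‖` is summable and the second moments of the noise are bounded, the filtered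
series converges in L² and almost surely absolutely. Comparing coefficients in `arPoly * transfer =
maPoly` shows pathwise that it solves the equation. Its cross covariances are double series in those
of the noise, hence shift invariant (`hasSum_crossCovOp_linear_filter`).

Uniqueness: in a Banach space the covariance operator does not determine `𝔼‖Y_t‖²`, so stationarity
gives no L² bound on a solution. It does fix `𝔼|f(Y_t - 𝔼Y_t)|²` for each functional `f`, which
bounds `∫_s Y_t` uniformly in `t` and in the event `s`. For fixed `s`, the integrals over `s` of the
difference of two solutions form a bounded deterministic solution of the homogeneous recursion.
Convolution with the Laurent coefficients of the inverse polynomial forces it to vanish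
(`eq_zero_of_bounded_of_homogeneous`), and set integrals determine a random variable almost
everywhere. -/

/-- The `n`-th Laurent coefficient at `0`, computed as an integral over the unit circle. -/
noncomputable def laurentCoeff (F : ℂ → V) (n : ℤ) : V :=
  (2 * Real.pi * Complex.I : ℂ)⁻¹ • ∮ z in C(0, 1), z ^ (-n - 1) • F z

theorem ne_zero_of_mem_sphere_zero_one {z : ℂ} (hz : z ∈ Metric.sphere (0 : ℂ) 1) : z ≠ 0 := by
  rintro rfl; simp at hz

theorem ContinuousOn.circleIntegrable_zpow_smul {F : ℂ → V}
    (hF : ContinuousOn F (Metric.sphere 0 1)) (m : ℤ) :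
    CircleIntegrable (fun z => z ^ m • F z) 0 1 :=
  ContinuousOn.circleIntegrable zero_le_one <| ContinuousOn.smul
    (fun z hz => (continuousAt_zpow₀ z m
      (Or.inl (ne_zero_of_mem_sphere_zero_one hz))).continuousWithinAt)
    hF

theorem laurentCoeff_congr {F G : ℂ → V} (h : ∀ z : ℂ, ‖z‖ = 1 → F z = G z) (n : ℤ) :
    laurentCoeff F n = laurentCoeff G n := by
  unfold laurentCoeff
  congr 1
  refine circleIntegral.integral_congr zero_le_one fun z hz => ?_
  simp only [h z (by simpa using hz)]

theorem laurentCoeff_sub {F G : ℂ → V} (hF : ContinuousOn F (Metric.sphere 0 1))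
    (hG : ContinuousOn G (Metric.sphere 0 1)) (n : ℤ) :
    laurentCoeff (fun z => F z - G z) n = laurentCoeff F n - laurentCoeff G n := by
  simp only [laurentCoeff, smul_sub]
  rw [circleIntegral.integral_sub (hF.circleIntegrable_zpow_smul _)
    (hG.circleIntegrable_zpow_smul _), smul_sub]

theorem laurentCoeff_sum {ι : Type*} (s : Finset ι) {F : ι → ℂ → V}
    (hF : ∀ i ∈ s, ContinuousOn (F i) (Metric.sphere 0 1)) (n : ℤ) :
    laurentCoeff (fun z => ∑ i ∈ s, F i z) n = ∑ i ∈ s, laurentCoeff (F i) n := by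
  simp only [laurentCoeff, Finset.smul_sum]
  rw [circleIntegral.integral_fun_sum fun i hi => (hF i hi).circleIntegrable_zpow_smul _,
    Finset.smul_sum]

theorem laurentCoeff_pow_smul (F : ℂ → V) (i : ℕ) (n : ℤ) :
    laurentCoeff (fun z => z ^ i • F z) n = laurentCoeff F (n - i) := by
  unfold laurentCoeff
  congr 1
  refine circleIntegral.integral_congr zero_le_one fun z hz => ?_
  simp only [smul_smul]
  rw [← zpow_natCast, ← zpow_add₀ (ne_zero_of_mem_sphere_zero_one hz)]
  congr 2
  ring

theorem laurentCoeff_clm_comp [CompleteSpace V] {W : Type*} [NormedAddCommGroup W]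
    [NormedSpace ℂ W] [CompleteSpace W] (L : V →L[ℂ] W) {F : ℂ → V}
    (hF : ContinuousOn F (Metric.sphere 0 1)) (n : ℤ) :
    laurentCoeff (fun z => L (F z)) n = L (laurentCoeff F n) := by
  simp only [laurentCoeff, circleIntegral, map_smul]
  rw [← L.intervalIntegral_comp_comm (hF.circleIntegrable_zpow_smul _).out]
  simp only [map_smul]

theorem laurentCoeff_const [CompleteSpace V] (v : V) (n : ℤ) :
    laurentCoeff (fun _ => v) n = if n = 0 then v else 0 := by
  unfold laurentCoeff
  rw [circleIntegral.integral_smul_const]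
  split_ifs with h
  · subst h
    have := circleIntegral.integral_sub_center_inv (0 : ℂ) (one_ne_zero (α := ℝ))
    simp only [sub_zero] at this
    simp only [neg_zero, zero_sub, zpow_neg_one, this, smul_smul]
    rw [inv_mul_cancel₀ Complex.two_pi_I_ne_zero, one_smul]
  · have := circleIntegral.integral_sub_zpow_of_ne (n := -n - 1) (by omega) (0 : ℂ) 0 1
    simp only [sub_zero] at this
    simp [this]

/-- Exterior expansion of a Cauchy integral. -/
theorem hasSum_circleIntegral_exterior {F : ℂ → V} {R : ℝ} (hR : 0 < R) {w : ℂ}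
    (hF : CircleIntegrable F 0 R) (hw : R < ‖w‖) :
    HasSum (fun n : ℕ => ∮ z in C(0, R), (z / w) ^ n • w⁻¹ • F z)
      (∮ z in C(0, R), (w - z)⁻¹ • F z) := by
  have hw0 : 0 < ‖w‖ := hR.trans hw
  have hwR : 0 ≤ R / ‖w‖ ∧ R / ‖w‖ < 1 := ⟨by positivity, (div_lt_one hw0).2 hw⟩
  refine intervalIntegral.hasSum_integral_of_dominated_convergence
      (fun n θ => R * ‖w‖⁻¹ * ‖F (circleMap 0 R θ)‖ * (R / ‖w‖) ^ n)
      (fun n => ?_) (fun n => ?_) ?_ ?_ ?_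
  · simp only [deriv_circleMap]
    apply_rules [AEStronglyMeasurable.smul, hF.def'.1] <;> apply Measurable.aestronglyMeasurable
    · fun_prop
    · fun_prop
    · fun_prop
  · refine Eventually.of_forall fun θ _ => le_of_eq ?_
    simp [norm_smul, abs_of_pos hR]
    ring
  · exact Eventually.of_forall fun _ _ => (summable_geometric_of_lt_one hwR.1 hwR.2).mul_left _
  · simp only [tsum_mul_left, tsum_geometric_of_lt_one hwR.1 hwR.2]
    exact (hF.norm.const_mul _).mul_const _
  · refine Eventually.of_forall fun θ _ => HasSum.const_smul _ ?_
    simp only [smul_smul]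
    refine HasSum.smul_const ?_ _
    have : ‖circleMap 0 R θ / w‖ < 1 := by simpa [abs_of_pos hR] using hwR.2
    convert! (hasSum_geometric_of_norm_lt_one this).mul_right _ using 1
    have hw' : w ≠ 0 := norm_pos_iff.1 hw0
    rw [← mul_inv, sub_mul, div_mul_cancel₀ _ hw', one_mul]

theorem circleIntegral_eq_of_differentiableOn_annulus {r R a b : ℝ} (hr : 0 < r)
    (ha : r < a) (haR : a < R) (hb : r < b) (hbR : b < R) {F : ℂ → V}
    (hF : DifferentiableOn ℂ F {z | r < ‖z‖ ∧ ‖z‖ < R}) :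
    (∮ z in C(0, a), F z) = ∮ z in C(0, b), F z := by
  have key : ∀ a b : ℝ, r < a → a ≤ b → b < R → (∮ z in C(0, b), F z) = ∮ z in C(0, a), F z := by
    intro a b ha hab hb
    have hopen : IsOpen {z : ℂ | r < ‖z‖ ∧ ‖z‖ < R} :=
      (isOpen_lt continuous_const continuous_norm).inter (isOpen_lt continuous_norm continuous_const)
    refine Complex.circleIntegral_eq_of_differentiable_on_annulus_off_countable (hr.trans ha) hab
      Set.countable_empty (hF.continuousOn.mono ?_) ?_
    · rintro z ⟨h1, h2⟩
      simp only [Metric.mem_closedBall, dist_zero_right, Metric.mem_ball, not_lt] at h1 h2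
      exact ⟨ha.trans_le h2, h1.trans_lt hb⟩
    · rintro z ⟨⟨h1, h2⟩, -⟩
      simp only [Metric.mem_closedBall, dist_zero_right, Metric.mem_ball, not_le] at h1 h2
      exact hF.differentiableAt (hopen.mem_nhds ⟨ha.trans h2, h1.trans hb⟩)
  rcases le_total a b with h | h
  · exact (key a b ha h hbR).symm
  · exact key b a hb h haR

theorem laurentCoeff_eq_circleIntegral {r R a : ℝ} (hr : 0 < r) (hr1 : r < 1) (hR : 1 < R)
    (ha : r < a) (haR : a < R) {F : ℂ → V}
    (hF : DifferentiableOn ℂ F {z | r < ‖z‖ ∧ ‖z‖ < R}) (n : ℤ) :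
    laurentCoeff F n
      = (2 * Real.pi * Complex.I : ℂ)⁻¹ • ∮ z in C(0, a), z ^ (-n - 1) • F z := by
  unfold laurentCoeff
  congr 1
  refine circleIntegral_eq_of_differentiableOn_annulus hr hr1 hR ha haR ?_
  refine DifferentiableOn.smul (fun z hz => ?_) hF
  exact (differentiableAt_zpow.2 (Or.inl (norm_pos_iff.1 (hr.trans hz.1)))).differentiableWithinAt

/-- The slope `(F z - F w) / (z - w)` extends holomorphically across `w`, so its integrals over the
two circles agree. Splitting it leaves `F w` times `∮ (z - w)⁻¹`, which is `2πi` on the outer circle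
and `0` on the inner one. -/
theorem cauchy_formula_annulus [CompleteSpace V] {r R a b : ℝ} (hr : 0 < r)
    (ha : r < a) (hab : a < b) (hbR : b < R) {F : ℂ → V}
    (hF : DifferentiableOn ℂ F {z | r < ‖z‖ ∧ ‖z‖ < R}) {w : ℂ} (haw : a < ‖w‖) (hwb : ‖w‖ < b) :
    (∮ z in C(0, b), (z - w)⁻¹ • F z) + (∮ z in C(0, a), (w - z)⁻¹ • F z)
      = (2 * Real.pi * Complex.I : ℂ) • F w := by
  have ha0 : 0 < a := hr.trans ha
  have hb0 : 0 < b := ha0.trans hab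
  have hopen : IsOpen {z : ℂ | r < ‖z‖ ∧ ‖z‖ < R} :=
    (isOpen_lt continuous_const continuous_norm).inter (isOpen_lt continuous_norm continuous_const)
  have hmem : {z : ℂ | r < ‖z‖ ∧ ‖z‖ < R} ∈ 𝓝 w :=
    hopen.mem_nhds ⟨ha.trans haw, hwb.trans hbR⟩
  have hslope := (Complex.differentiableOn_dslope hmem).2 hF
  have heq := circleIntegral_eq_of_differentiableOn_annulus hr (ha.trans hab) hbR ha
    (hab.trans hbR) hslope
  have hint : ∀ c, r < c → c < R → c ≠ ‖w‖ →
      (∮ z in C(0, c), dslope F w z)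
        = (∮ z in C(0, c), (z - w)⁻¹ • F z) - (∮ z in C(0, c), (z - w)⁻¹) • F w := by
    intro c hc hcR hcw
    have hne : ∀ z ∈ Metric.sphere (0 : ℂ) c, z ≠ w := by
      rintro z hz rfl
      simp at hz
      exact hcw hz.symm
    have hinv : ContinuousOn (fun z : ℂ => (z - w)⁻¹) (Metric.sphere 0 c) :=
      (continuousOn_id.sub continuousOn_const).inv₀ fun z hz => sub_ne_zero.2 (hne z hz)
    have hFc : ContinuousOn F (Metric.sphere 0 c) := hF.continuousOn.mono fun z hz => by
      simp at hz
      simp [hz, hc, hcR]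
    have h1 : CircleIntegrable (fun z => (z - w)⁻¹ • F z) 0 c :=
      (hinv.smul hFc).circleIntegrable (hr.trans hc).le
    have h2 : CircleIntegrable (fun z => (z - w)⁻¹ • F w) 0 c :=
      (hinv.smul continuousOn_const).circleIntegrable (hr.trans hc).le
    rw [← circleIntegral.integral_smul_const, ← circleIntegral.integral_sub h1 h2]
    refine circleIntegral.integral_congr (hr.trans hc).le fun z hz => ?_
    rw [dslope_of_ne _ (hne z hz), slope_def_module, smul_sub]
  rw [hint b (ha.trans hab) hbR hwb.ne', hint a ha (hab.trans hbR) haw.ne,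
    circleIntegral.integral_sub_inv_of_mem_ball (by simpa using hwb)] at heq
  have hzero : (∮ z in C(0, a), (z - w)⁻¹) = 0 := by
    refine Complex.circleIntegral_eq_zero_of_differentiable_on_off_countable ha0.le
      Set.countable_empty ?_ ?_
    · refine (continuousOn_id.sub continuousOn_const).inv₀ fun z hz => sub_ne_zero.2 ?_
      rintro rfl
      simp at hz
      exact absurd haw (not_lt.2 hz)
    · rintro z ⟨hz, -⟩
      have hne : z - w ≠ 0 := by
        rw [sub_ne_zero]
        rintro rfl
        simp at hz
        exact absurd haw hz.not_gt
      exact (differentiableAt_id.sub_const w).inv hne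
  rw [hzero, zero_smul, sub_zero] at heq
  have hneg : (∮ z in C(0, a), (w - z)⁻¹ • F z) = -∮ z in C(0, a), (z - w)⁻¹ • F z := by
    rw [← neg_one_smul ℂ, ← circleIntegral.integral_smul]
    refine circleIntegral.integral_congr ha0.le fun z _ => ?_
    simp only [neg_smul, one_smul]
    rw [← neg_sub z w, inv_neg, neg_smul]
  rw [hneg, ← heq]
  abel

/-- In Cauchy's formula the kernel is a geometric series in `w / z` on the outer circle, giving the
indices `n ≥ 0`, and in `z / w` on the inner circle, giving the indices `-(n + 1)`. Each coefficient
may be computed on whichever circle is needed. -/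
theorem hasSum_laurent [CompleteSpace V] {r R : ℝ} (hr : 0 < r) (hr1 : r < 1) (hR : 1 < R)
    {F : ℂ → V} (hF : DifferentiableOn ℂ F {z | r < ‖z‖ ∧ ‖z‖ < R}) {w : ℂ}
    (hrw : r < ‖w‖) (hwR : ‖w‖ < R) :
    HasSum (fun k : ℤ => w ^ k • laurentCoeff F k) (F w) := by
  obtain ⟨a, hra, haw⟩ := exists_between hrw
  obtain ⟨b, hwb, hbR⟩ := exists_between hwR
  have ha0 : 0 < a := hr.trans hra
  have hb0 : 0 < b := ha0.trans (haw.trans hwb)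
  have hw0 : w ≠ 0 := norm_pos_iff.1 (hr.trans hrw)
  have hci : ∀ c, r < c → c < R → CircleIntegrable F 0 c := fun c hc hcR =>
    (hF.continuousOn.mono fun z hz => by
      simp at hz
      simp [hz, hc, hcR]).circleIntegrable (hr.trans hc).le
  have hpi : (2 * Real.pi * Complex.I : ℂ) ≠ 0 := Complex.two_pi_I_ne_zero
  have houter := (hasSum_two_pi_I_cauchyPowerSeries_integral
    (hci b (hra.trans (haw.trans hwb)) hbR) hwb).const_smul (2 * Real.pi * Complex.I : ℂ)⁻¹
  have hinner := (hasSum_circleIntegral_exterior ha0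
    (hci a hra (haw.trans hwR)) haw).const_smul (2 * Real.pi * Complex.I : ℂ)⁻¹
  simp only [zero_add, sub_zero] at houter
  have hsum := cauchy_formula_annulus hr hra (haw.trans hwb) hbR hF haw hwb
  have hFw : F w = (2 * Real.pi * Complex.I : ℂ)⁻¹ • (∮ z in C(0, b), (z - w)⁻¹ • F z)
      + (2 * Real.pi * Complex.I : ℂ)⁻¹ • ∮ z in C(0, a), (w - z)⁻¹ • F z := by
    rw [← smul_add, hsum, smul_smul, inv_mul_cancel₀ hpi, one_smul]
  rw [hFw]
  refine HasSum.of_nat_of_neg_add_one ?_ ?_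
  · convert! houter using 1
    funext n
    rw [laurentCoeff_eq_circleIntegral hr hr1 hR (hra.trans (haw.trans hwb)) hbR hF, smul_comm,
      ← circleIntegral.integral_smul]
    congr 1
    refine circleIntegral.integral_congr hb0.le fun z hz => ?_
    have hz0 : z ≠ 0 := by
      rintro rfl
      simp at hz
      exact hb0.ne hz
    simp only [smul_smul]
    congr 1
    rw [sub_eq_add_neg, zpow_add₀ hz0, zpow_neg, zpow_natCast, zpow_natCast, zpow_neg_one, div_pow]
    field_simp
  · convert! hinner using 1
    funext n
    rw [laurentCoeff_eq_circleIntegral hr hr1 hR hra (haw.trans hwR) hF, smul_comm,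
      ← circleIntegral.integral_smul]
    congr 1
    refine circleIntegral.integral_congr ha0.le fun z hz => ?_
    simp only [smul_smul]
    congr 1
    rw [show (-(-((n : ℤ) + 1)) - 1 : ℤ) = n by ring, zpow_natCast, zpow_neg, zpow_add₀ hw0,
      zpow_natCast, zpow_one, div_pow]
    field_simp

/-- The terms of a convergent Laurent series are bounded. A radius `b > 1` gives decay `b⁻ⁿ` for
positive indices, a radius `a < 1` gives decay `aⁿ` for negative ones. -/
theorem summable_norm_laurentCoeff [CompleteSpace V] {r R : ℝ} (hr : 0 < r) (hr1 : r < 1)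
    (hR : 1 < R) {F : ℂ → V} (hF : DifferentiableOn ℂ F {z | r < ‖z‖ ∧ ‖z‖ < R}) :
    Summable fun k : ℤ => ‖laurentCoeff F k‖ := by
  have key : ∀ ρ : ℝ, r < ρ → ρ < R → ∃ M, ∀ k : ℤ, ρ ^ k * ‖laurentCoeff F k‖ ≤ M := by
    intro ρ h1 h2
    have hρ : 0 < ρ := hr.trans h1
    have hn : ‖(ρ : ℂ)‖ = ρ := by simp [abs_of_pos hρ]
    have hs := (hasSum_laurent hr hr1 hR hF (w := (ρ : ℂ)) (by rwa [hn]) (by rwa [hn])).summable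
    have hb := hs.tendsto_cofinite_zero.norm.bddAbove_range_of_cofinite
    obtain ⟨M, hM⟩ := hb
    refine ⟨M, fun k => ?_⟩
    have := hM (Set.mem_range_self k)
    simpa only [norm_smul, norm_zpow, hn] using this
  obtain ⟨a, hra, ha1⟩ := exists_between hr1
  obtain ⟨b, h1b, hbR⟩ := exists_between hR
  have ha0 : 0 < a := hr.trans hra
  have hb0 : 0 < b := zero_lt_one.trans h1b
  obtain ⟨M, hM⟩ := key a hra (ha1.trans hR)
  obtain ⟨N, hN⟩ := key b (hr1.trans h1b) hbR
  refine Summable.of_nat_of_neg_add_one ?_ ?_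
  · refine Summable.of_nonneg_of_le (fun _ => norm_nonneg _) (fun n => ?_)
      ((summable_geometric_of_lt_one (inv_nonneg.2 hb0.le) (inv_lt_one_of_one_lt₀ h1b)).mul_left N)
    have := hN n
    rw [zpow_natCast] at this
    rw [inv_pow, ← div_eq_mul_inv, le_div_iff₀ (by positivity), mul_comm]
    exact this
  · refine Summable.of_nonneg_of_le (fun _ => norm_nonneg _) (fun n => ?_)
      ((summable_geometric_of_lt_one ha0.le ha1).mul_left (M * a))
    have := hM (-(n + 1))
    rw [zpow_neg, inv_mul_le_iff₀ (by positivity), zpow_add₀ ha0.ne', zpow_natCast, zpow_one] at this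
    linarith

end Laurent

theorem hasSum_int_sub {M : Type*} [AddCommMonoid M] [TopologicalSpace M] {f : ℤ → M} {a : M}
    (h : HasSum f a) (i : ℤ) : HasSum (fun n => f (n - i)) a :=
  (Equiv.subRight i).hasSum_iff.2 h

/-! ### Coefficients of the transfer function and the deterministic recursion -/

section Coefficients

variable {E : Type*} [NormedAddCommGroup E] [NormedSpace ℂ E]

theorem arPoly_eq_smul_armaQ (p : ℕ) (A : ℕ → E →L[ℂ] E) {z : ℂ} (hz : z ≠ 0) :
    arPoly p A z = z ^ p • armaQ p A z⁻¹ := by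
  unfold arPoly armaQ
  rw [smul_sub, smul_smul, ← mul_pow, mul_inv_cancel₀ hz, one_pow, one_smul, Finset.smul_sum]
  congr 1
  refine Finset.sum_congr rfl fun i hi => ?_
  rw [smul_smul]
  congr 1
  obtain ⟨k, rfl⟩ := Nat.exists_eq_add_of_le (Finset.mem_Icc.1 hi).2
  rw [Nat.add_sub_cancel_left, pow_add, mul_assoc, ← mul_pow, mul_inv_cancel₀ hz, one_pow, mul_one]

theorem isUnit_arPoly_of_norm_eq_one {p : ℕ} {A : ℕ → E →L[ℂ] E}
    (hQ : ∀ z : ℂ, ‖z‖ = 1 → IsUnit (armaQ p A z)) {z : ℂ} (hz : ‖z‖ = 1) :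
    IsUnit (arPoly p A z) := by
  have hz0 : z ≠ 0 := by
    rintro rfl
    simp at hz
  rw [arPoly_eq_smul_armaQ p A hz0]
  exact (hQ z⁻¹ (by simp [hz])).smul (Units.mk0 (z ^ p) (pow_ne_zero p hz0))

theorem differentiable_arPoly (p : ℕ) (A : ℕ → E →L[ℂ] E) : Differentiable ℂ (arPoly p A) := by
  unfold arPoly
  fun_prop

theorem differentiable_maPoly (q : ℕ) (B : ℕ → E →L[ℂ] E) : Differentiable ℂ (maPoly q B) := by
  unfold maPoly
  fun_prop

theorem arPoly_mul (p : ℕ) (A : ℕ → E →L[ℂ] E) (z : ℂ) (T : E →L[ℂ] E) :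
    arPoly p A z * T = T - ∑ i ∈ Finset.Icc 1 p, z ^ i • (A i * T) := by
  simp [arPoly, sub_mul, Finset.sum_mul]

theorem mul_arPoly (p : ℕ) (A : ℕ → E →L[ℂ] E) (z : ℂ) (T : E →L[ℂ] E) :
    T * arPoly p A z = T - ∑ i ∈ Finset.Icc 1 p, z ^ i • (T * A i) := by
  simp [arPoly, mul_sub, Finset.mul_sum]

variable [CompleteSpace E]

theorem exists_annulus_isUnit_arPoly {p : ℕ} {A : ℕ → E →L[ℂ] E}
    (hQ : ∀ z : ℂ, ‖z‖ = 1 → IsUnit (armaQ p A z)) :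
    ∃ r R : ℝ, 0 < r ∧ r < 1 ∧ 1 < R ∧
      ∀ z : ℂ, r < ‖z‖ → ‖z‖ < R → IsUnit (arPoly p A z) := by
  have hopen : IsOpen {z : ℂ | IsUnit (arPoly p A z)} :=
    Units.isOpen.preimage (differentiable_arPoly p A).continuous
  obtain ⟨δ, hδ, hsub⟩ := (isCompact_sphere (0 : ℂ) 1).exists_thickening_subset_open hopen
    fun z hz => isUnit_arPoly_of_norm_eq_one hQ (by simpa using hz)
  -- The `1 / 2` keeps the inner radius positive when `δ ≥ 1`.
  refine ⟨max (1 - δ) (1 / 2), 1 + δ, by positivity, max_lt (by linarith) (by norm_num),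
    by linarith, fun z h1 h2 => hsub ?_⟩
  have hz : 0 < ‖z‖ := (by positivity : (0 : ℝ) < max (1 - δ) (1 / 2)).trans h1
  have h3 := (le_max_left _ _).trans_lt h1
  rw [Metric.mem_thickening_iff]
  -- The radial projection `z / ‖z‖` lies on the circle at distance `|‖z‖ - 1|` from `z`.
  refine ⟨((‖z‖⁻¹ : ℝ) : ℂ) * z, by simp [hz.ne'], ?_⟩
  rw [dist_eq_norm, show z - ((‖z‖⁻¹ : ℝ) : ℂ) * z = ((1 - ‖z‖⁻¹ : ℝ) : ℂ) * z by push_cast; ring,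
    norm_mul, Complex.norm_real, Real.norm_eq_abs, ← abs_of_pos hz, ← abs_mul, abs_of_pos hz,
    sub_mul, inv_mul_cancel₀ hz.ne', abs_lt]
  constructor <;> linarith

theorem differentiableOn_armaTransfer {p : ℕ} {A : ℕ → E →L[ℂ] E} {s : Set ℂ}
    (h : ∀ z ∈ s, IsUnit (arPoly p A z)) (q : ℕ) (B : ℕ → E →L[ℂ] E) :
    DifferentiableOn ℂ (armaTransfer p q A B) s := fun z hz => by
  have h1 : DifferentiableAt ℂ (fun z => Ring.inverse (arPoly p A z)) z :=
    (differentiableAt_inverse (𝕜 := ℂ) (h z hz)).comp z (differentiable_arPoly p A z)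
  exact (h1.mul (differentiable_maPoly q B z)).differentiableWithinAt

theorem continuousOn_armaTransfer {p : ℕ} {A : ℕ → E →L[ℂ] E}
    (hQ : ∀ z : ℂ, ‖z‖ = 1 → IsUnit (armaQ p A z)) (q : ℕ) (B : ℕ → E →L[ℂ] E) :
    ContinuousOn (armaTransfer p q A B) (Metric.sphere 0 1) :=
  (differentiableOn_armaTransfer
    (fun _ hz => isUnit_arPoly_of_norm_eq_one hQ (by simpa using hz)) q B).continuousOn

theorem summable_norm_armaCoeff {p : ℕ} {A : ℕ → E →L[ℂ] E}
    (hQ : ∀ z : ℂ, ‖z‖ = 1 → IsUnit (armaQ p A z)) (q : ℕ) (B : ℕ → E →L[ℂ] E) :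
    Summable fun k : ℤ => ‖armaCoeff p q A B k‖ := by
  obtain ⟨r, R, hr, hr1, hR, h⟩ := exists_annulus_isUnit_arPoly hQ
  exact summable_norm_laurentCoeff hr hr1 hR
    (differentiableOn_armaTransfer (fun z hz => h z hz.1 hz.2) q B)

theorem laurentCoeff_maPoly (q : ℕ) (B : ℕ → E →L[ℂ] E) (n : ℤ) :
    laurentCoeff (maPoly q B) n = ∑ k ∈ Finset.range (q + 1), if n = k then B k else 0 := by
  unfold maPoly
  rw [laurentCoeff_sum _ fun k _ => by fun_prop]
  refine Finset.sum_congr rfl fun k _ => ?_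
  rw [laurentCoeff_pow_smul, laurentCoeff_const]
  simp only [sub_eq_zero]

/-- The transfer function satisfies `(id - z A₁ - ⋯ - z^p A_p) F(z) = B₀ + ⋯ + z^q B_q`; comparison
of coefficients. -/
theorem armaCoeff_sub_sum {p : ℕ} {A : ℕ → E →L[ℂ] E}
    (hQ : ∀ z : ℂ, ‖z‖ = 1 → IsUnit (armaQ p A z)) (q : ℕ) (B : ℕ → E →L[ℂ] E) (n : ℤ) :
    armaCoeff p q A B n - ∑ i ∈ Finset.Icc 1 p, A i * armaCoeff p q A B (n - i)
      = ∑ k ∈ Finset.range (q + 1), if n = k then B k else 0 := by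
  have hc := continuousOn_armaTransfer hQ q B
  have hcA : ∀ i, ContinuousOn (fun z => A i * armaTransfer p q A B z) (Metric.sphere 0 1) :=
    fun i => continuousOn_const.mul hc
  have hcS : ∀ i : ℕ, ContinuousOn (fun z : ℂ => z ^ i • (A i * armaTransfer p q A B z))
      (Metric.sphere 0 1) := fun i => (continuousOn_pow i).smul (hcA i)
  rw [← laurentCoeff_maPoly, ← laurentCoeff_congr (F := fun z => armaTransfer p q A B z
    - ∑ i ∈ Finset.Icc 1 p, z ^ i • (A i * armaTransfer p q A B z))]
  · rw [laurentCoeff_sub hc (continuousOn_finsetSum _ fun i _ => hcS i),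
      laurentCoeff_sum _ fun i _ => hcS i]
    congr 1
    refine Finset.sum_congr rfl fun i _ => ?_
    rw [laurentCoeff_pow_smul]
    exact (laurentCoeff_clm_comp (ContinuousLinearMap.mul ℂ (E →L[ℂ] E) (A i)) hc _).symm
  · intro z hz
    rw [← arPoly_mul, armaTransfer, Ring.mul_inverse_cancel_left _ _
      (isUnit_arPoly_of_norm_eq_one hQ hz)]

/-- The Laurent coefficients `φ_n` of `(id - z A₁ - ⋯ - z^p A_p)⁻¹` satisfy
`φ_n - φ_(n-1) A₁ - ⋯ - φ_(n-p) A_p = δ_(n,0)`. -/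
theorem inverseCoeff_sub_sum {p : ℕ} {A : ℕ → E →L[ℂ] E}
    (hQ : ∀ z : ℂ, ‖z‖ = 1 → IsUnit (armaQ p A z)) (n : ℤ) :
    armaCoeff p 0 A 1 n - ∑ i ∈ Finset.Icc 1 p, armaCoeff p 0 A 1 (n - i) * A i
      = if n = 0 then 1 else 0 := by
  have hc := continuousOn_armaTransfer hQ 0 1
  have hcA : ∀ i, ContinuousOn (fun z => armaTransfer p 0 A 1 z * A i) (Metric.sphere 0 1) :=
    fun i => hc.mul continuousOn_const
  have hcS : ∀ i : ℕ, ContinuousOn (fun z : ℂ => z ^ i • (armaTransfer p 0 A 1 z * A i))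
      (Metric.sphere 0 1) := fun i => (continuousOn_pow i).smul (hcA i)
  rw [← laurentCoeff_const (1 : E →L[ℂ] E) n, ← laurentCoeff_congr (F := fun z =>
    armaTransfer p 0 A 1 z - ∑ i ∈ Finset.Icc 1 p, z ^ i • (armaTransfer p 0 A 1 z * A i))]
  · rw [laurentCoeff_sub hc (continuousOn_finsetSum _ fun i _ => hcS i),
      laurentCoeff_sum _ fun i _ => hcS i]
    congr 1
    refine Finset.sum_congr rfl fun i _ => ?_
    rw [laurentCoeff_pow_smul]
    exact (laurentCoeff_clm_comp ((ContinuousLinearMap.mul ℂ (E →L[ℂ] E)).flip (A i)) hc _).symm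
  · intro z hz
    have : maPoly 0 (1 : ℕ → E →L[ℂ] E) z = 1 := by simp [maPoly]
    rw [← mul_arPoly, armaTransfer, this, mul_one,
      Ring.inverse_mul_cancel _ (isUnit_arPoly_of_norm_eq_one hQ hz)]

/-- Filtering an input `z` with the Laurent coefficients of the transfer function solves the
deterministic ARMA equation. -/
theorem armaSeries_sub_sum {p : ℕ} {A : ℕ → E →L[ℂ] E}
    (hQ : ∀ z : ℂ, ‖z‖ = 1 → IsUnit (armaQ p A z)) (q : ℕ) (B : ℕ → E →L[ℂ] E)
    {z : ℤ → E} {y : ℤ → E}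
    (hy : ∀ t, HasSum (fun k => armaCoeff p q A B k (z (t - k))) (y t)) (t : ℤ) :
    y t - ∑ i ∈ Finset.Icc 1 p, A i (y (t - i))
      = ∑ k ∈ Finset.range (q + 1), B k (z (t - k)) := by
  -- The series for `y (t - i)` is reindexed by `n = k + i`, so that everything acting on `z (t -
  -- n)` is collected.
  have h1 : HasSum (fun n : ℤ => armaCoeff p q A B n (z (t - n))
      - ∑ i ∈ Finset.Icc 1 p, A i (armaCoeff p q A B (n - i) (z (t - n))))
      (y t - ∑ i ∈ Finset.Icc 1 p, A i (y (t - i))) := by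
    refine (hy t).sub (hasSum_sum fun i _ => (A i).hasSum ?_)
    convert! hasSum_int_sub (hy (t - i)) i using 4
    ring
  have h2 : HasSum (fun n : ℤ => ∑ k ∈ Finset.range (q + 1),
      if n = k then B k (z (t - k)) else 0) (∑ k ∈ Finset.range (q + 1), B k (z (t - k))) :=
    hasSum_sum fun k _ => hasSum_ite_eq (k : ℤ) (B k (z (t - k)))
  refine h1.unique ?_
  convert! h2 using 1
  funext n
  have := congrArg (fun T : E →L[ℂ] E => T (z (t - n))) (armaCoeff_sub_sum hQ q B n)
  simp only [sub_apply, sum_apply] at this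
  refine this.trans ?_
  refine Finset.sum_congr rfl fun k _ => ?_
  split_ifs with h
  · rw [h]
  · rfl

/-- Bounded solutions of the homogeneous equation vanish. -/
theorem eq_zero_of_bounded_of_homogeneous {p : ℕ} {A : ℕ → E →L[ℂ] E}
    (hQ : ∀ z : ℂ, ‖z‖ = 1 → IsUnit (armaQ p A z)) {x : ℤ → E} {K : ℝ} (hK : ∀ t, ‖x t‖ ≤ K)
    (hx : ∀ t, x t - ∑ i ∈ Finset.Icc 1 p, A i (x (t - i)) = 0) (t : ℤ) : x t = 0 := by
  -- With `q = 0` and `B = 1` the moving average factor is the identity, so `φ` expands the inverse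
  -- polynomial itself.
  set φ := armaCoeff p 0 A 1 with hφ
  have hsum : ∀ y : ℤ → E, (∃ K, ∀ t, ‖y t‖ ≤ K) → Summable fun n => φ n (y n) := by
    rintro y ⟨K, hK⟩
    refine Summable.of_norm_bounded ((summable_norm_armaCoeff hQ 0 1).mul_right K) fun n => ?_
    exact (φ n).le_of_opNorm_le_of_le le_rfl (hK n)
  have hA : ∀ i : ℕ, HasSum (fun n : ℤ => φ (n - i) (A i (x (t - n))))
      (∑' n, φ n (A i (x (t - n - i)))) := by
    intro i
    have := (hsum (fun n => A i (x (t - n - i)))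
      ⟨‖A i‖ * K, fun n => (A i).le_of_opNorm_le_of_le le_rfl (hK _)⟩).hasSum
    convert! hasSum_int_sub this (i : ℤ) using 5
    ring
  have h0 := (hsum (fun n => x (t - n)) ⟨K, fun n => hK _⟩).hasSum
  -- `h1` and `h2` evaluate the same quantity. After the index shift the right-sided coefficient
  -- identity leaves only `x t`; unshifted, each term is `φ n` applied to the homogeneous equation
  -- at time `t - n`.
  have h1 := h0.sub (hasSum_sum fun i (_ : i ∈ Finset.Icc 1 p) => hA i)
  have h2 := h0.sub (hasSum_sum fun i (_ : i ∈ Finset.Icc 1 p) =>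
    (hsum (fun n => A i (x (t - n - i)))
      ⟨‖A i‖ * K, fun n => (A i).le_of_opNorm_le_of_le le_rfl (hK _)⟩).hasSum)
  have h3 : HasSum (fun n : ℤ => if n = 0 then x t else 0) (x t) := hasSum_ite_eq 0 (x t)
  have h4 : (fun n : ℤ => φ n (x (t - n)) - ∑ i ∈ Finset.Icc 1 p, φ (n - i) (A i (x (t - n))))
      = fun n : ℤ => if n = 0 then x t else 0 := by
    funext n
    have := congrArg (fun T : E →L[ℂ] E => T (x (t - n))) (inverseCoeff_sub_sum hQ n)
    simp only [sub_apply, sum_apply] at this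
    refine this.trans ?_
    split_ifs with h
    · simp [h]
    · rfl
  have h5 : (fun n : ℤ => φ n (x (t - n)) - ∑ i ∈ Finset.Icc 1 p, φ n (A i (x (t - n - i))))
      = fun _ => 0 := by
    funext n
    rw [← map_sum, ← map_sub, hx, map_zero]
  rw [h4] at h1
  rw [h5] at h2
  rw [h3.unique h1, h2.unique hasSum_zero]

end Coefficients

/-! ### Series of L² random variables and moment estimates -/

section RandomSeries

variable {E : Type*} [NormedAddCommGroup E] {Ω : Type*} [MeasurableSpace Ω] {P : Measure Ω}

/-- A series of `L²` random variables with summable norms converges in `L²` and almost surely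
absolutely. -/
theorem exists_hasSum_ae_and_tendsto_eLpNorm [CompleteSpace E] {ι : Type*} [Countable ι]
    {X : ι → Ω → E} (hX : ∀ k, MemLp (X k) 2 P) (hsum : ∑' k, eLpNorm (X k) 2 P ≠ ⊤) :
    ∃ S : Ω → E, StronglyMeasurable S ∧ MemLp S 2 P ∧
      (∀ᵐ ω ∂P, Summable (fun k => ‖X k ω‖) ∧ HasSum (fun k => X k ω) (S ω)) ∧
      Tendsto (fun s : Finset ι => eLpNorm (fun ω => S ω - ∑ k ∈ s, X k ω) 2 P) atTop (𝓝 0) := by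
  have hX' : ∀ᵐ ω ∂P, ∀ k, (hX k).toLp (X k) ω = X k ω :=
    ae_all_iff.2 fun k => (hX k).coeFn_toLp
  have hf : ∑' k, ‖(hX k).toLp (X k)‖ₑ ≠ ⊤ := by simpa only [Lp.enorm_toLp] using hsum
  refine ⟨⇑(∑' k, (hX k).toLp (X k)), Lp.stronglyMeasurable _, Lp.memLp _, ?_, ?_⟩
  · filter_upwards [hX', Lp.hasSum_coeFn_tsum hf,
      summable_norm_of_tsum_eLpNorm_ne_top one_le_two (fun k => (hX k).1) hsum] with ω h1 h2 h3
    simp only [h1] at h2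
    exact ⟨h3, h2⟩
  · have h := (Lp.tendsto_Lp_iff_tendsto_eLpNorm' _ _).1 (Summable.of_enorm hf).hasSum
    refine h.congr fun s => ?_
    rw [← eLpNorm_neg]
    refine eLpNorm_congr_ae ?_
    filter_upwards [Lp.coeFn_fun_finsetSum s fun k => (hX k).toLp (X k), hX'] with ω h1 h2
    simp only [Pi.neg_apply, Pi.sub_apply, neg_sub, h1, h2]

theorem integral_norm_mul_norm_le {X Y : Ω → E} (hX : MemLp X 2 P) (hY : MemLp Y 2 P) {C : ℝ}
    (hXC : ∫ ω, ‖X ω‖ ^ 2 ∂P ≤ C) (hYC : ∫ ω, ‖Y ω‖ ^ 2 ∂P ≤ C) :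
    ∫ ω, ‖X ω‖ * ‖Y ω‖ ∂P ≤ C := by
  have h1 := hX.norm.integrable_sq
  have h2 := hY.norm.integrable_sq
  calc ∫ ω, ‖X ω‖ * ‖Y ω‖ ∂P ≤ ∫ ω, 1 / 2 * (‖X ω‖ ^ 2 + ‖Y ω‖ ^ 2) ∂P :=
        integral_mono (hX.norm.integrable_mul hY.norm) ((h1.add h2).const_mul _) fun ω => by
          have := two_mul_le_add_sq ‖X ω‖ ‖Y ω‖
          simp only
          linarith
    _ = 1 / 2 * (∫ ω, ‖X ω‖ ^ 2 ∂P + ∫ ω, ‖Y ω‖ ^ 2 ∂P) := by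
        rw [integral_const_mul, integral_add h1 h2]
    _ ≤ C := by linarith

theorem integral_norm_le_one_add [IsProbabilityMeasure P] {X : Ω → E} (hX : MemLp X 2 P) :
    ∫ ω, ‖X ω‖ ∂P ≤ 1 + ∫ ω, ‖X ω‖ ^ 2 ∂P := by
  have h1 := hX.norm.integrable_sq
  calc ∫ ω, ‖X ω‖ ∂P ≤ ∫ ω, (1 + ‖X ω‖ ^ 2) ∂P :=
        integral_mono (hX.norm.integrable one_le_two) ((integrable_const _).add h1) fun ω => by
          simp only
          nlinarith [sq_nonneg (‖X ω‖ - 1), norm_nonneg (X ω)]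
    _ = 1 + ∫ ω, ‖X ω‖ ^ 2 ∂P := by
        rw [integral_add (integrable_const _) h1]
        simp

theorem eLpNorm_two_le_of_integral_sq_le {X : Ω → E} (hX : MemLp X 2 P) {C : ℝ}
    (hC : ∫ ω, ‖X ω‖ ^ 2 ∂P ≤ C) : eLpNorm X 2 P ≤ ENNReal.ofReal (√C) := by
  rw [hX.eLpNorm_eq_integral_rpow_norm two_ne_zero ENNReal.ofNat_ne_top]
  refine ENNReal.ofReal_le_ofReal ?_
  rw [Real.sqrt_eq_rpow]
  simp only [ENNReal.toReal_ofNat, Real.rpow_ofNat, one_div]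
  exact Real.rpow_le_rpow (integral_nonneg fun ω => by positivity) hC (by norm_num)

end RandomSeries

/-! ### Summable filters: convergence, mean and covariance -/

section Filters

variable {E : Type*} [NormedAddCommGroup E] [NormedSpace ℂ E]
  {Ω : Type*} [MeasurableSpace Ω] {P : Measure Ω}

theorem crossCovOp_of_centered {X Y : Ω → E} (hX : ∫ ω, X ω ∂P = 0) (hY : ∫ ω, Y ω ∂P = 0)
    (f : StrongDual ℂ E) :
    crossCovOp P X Y f = ∫ ω, (starRingEnd ℂ) (f (X ω)) • Y ω ∂P := by
  simp only [crossCovOp, hX, hY, sub_zero]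

theorem norm_conj_smul_le (f : StrongDual ℂ E) (x y : E) :
    ‖(starRingEnd ℂ) (f x) • y‖ ≤ ‖f‖ * (‖x‖ * ‖y‖) := by
  rw [norm_smul, RCLike.norm_conj, ← mul_assoc]
  exact mul_le_mul_of_nonneg_right (f.le_opNorm x) (norm_nonneg y)

theorem MeasureTheory.MemLp.integrable_conj_smul {X Y : Ω → E} (hX : MemLp X 2 P)
    (hY : MemLp Y 2 P) (f : StrongDual ℂ E) :
    Integrable (fun ω => (starRingEnd ℂ) (f (X ω)) • Y ω) P := by
  refine Integrable.mono' ((hX.norm.integrable_mul hY.norm).const_mul ‖f‖) ?_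
    (Eventually.of_forall fun ω => norm_conj_smul_le f (X ω) (Y ω))
  exact (Complex.continuous_conj.comp_aestronglyMeasurable
    (f.continuous.comp_aestronglyMeasurable hX.1)).smul hY.1

variable [CompleteSpace E] {W : ℤ → Ω → E} (hW : ∀ t, MemLp (W t) 2 P) {C : ℝ}
  (hC : ∀ t, ∫ ω, ‖W t ω‖ ^ 2 ∂P ≤ C) {ψ : ℤ → E →L[ℂ] E} (hψ : Summable fun k => ‖ψ k‖)

include hW hC hψ

/-- A summable filter of an `L²`-bounded process. -/
theorem exists_linear_filter (t : ℤ) :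
    ∃ S : Ω → E, StronglyMeasurable S ∧ MemLp S 2 P ∧
      (∀ᵐ ω ∂P, Summable (fun k => ‖ψ k (W (t - k) ω)‖) ∧
        HasSum (fun k => ψ k (W (t - k) ω)) (S ω)) ∧
      Tendsto (fun s : Finset ℤ =>
        eLpNorm (fun ω => S ω - ∑ k ∈ s, ψ k (W (t - k) ω)) 2 P) atTop (𝓝 0) := by
  refine exists_hasSum_ae_and_tendsto_eLpNorm
    (fun k => (hW (t - k)).continuousLinearMap_comp (ψ k)) ?_
  -- The uniform bound on second moments makes the L² norms of the terms summable along with `‖ψ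
  -- k‖`.
  have hbound : ∀ k, eLpNorm (fun ω => ψ k (W (t - k) ω)) 2 P
      ≤ ENNReal.ofReal (‖ψ k‖ * √C) := by
    intro k
    rw [ENNReal.ofReal_mul (norm_nonneg _)]
    refine (eLpNorm_le_mul_eLpNorm_of_ae_le_mul
      (Eventually.of_forall fun ω => (ψ k).le_opNorm (W (t - k) ω)) 2).trans ?_
    gcongr
    exact eLpNorm_two_le_of_integral_sq_le (hW _) (hC _)
  refine ne_top_of_le_ne_top ?_ (ENNReal.tsum_le_tsum hbound)
  rw [← ENNReal.ofReal_tsum_of_nonneg (fun k => by positivity) (hψ.mul_right _)]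
  exact ENNReal.ofReal_ne_top

variable [IsProbabilityMeasure P]

theorem integral_linear_filter_eq_zero (h0 : ∀ t, ∫ ω, W t ω ∂P = 0) {S : Ω → E} {t : ℤ}
    (hS : ∀ᵐ ω ∂P, HasSum (fun k => ψ k (W (t - k) ω)) (S ω)) : ∫ ω, S ω ∂P = 0 := by
  have hint : ∀ k, Integrable (W k) P := fun k => (hW k).integrable one_le_two
  have h := hasSum_integral_of_summable_integral_norm (μ := P)
    (F := fun k ω => ψ k (W (t - k) ω)) (fun k => (ψ k).integrable_comp (hint _)) <| by
      refine Summable.of_nonneg_of_le (fun k => integral_nonneg fun ω => norm_nonneg _)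
        (fun k => ?_) (hψ.mul_right (1 + C))
      calc ∫ ω, ‖ψ k (W (t - k) ω)‖ ∂P ≤ ∫ ω, ‖ψ k‖ * ‖W (t - k) ω‖ ∂P :=
            integral_mono ((ψ k).integrable_comp (hint _)).norm ((hint _).norm.const_mul _)
              fun ω => (ψ k).le_opNorm _
        _ ≤ ‖ψ k‖ * (1 + C) := by
            rw [integral_const_mul]
            gcongr
            exact (integral_norm_le_one_add (hW _)).trans (by linarith [hC (t - k)])
  rw [integral_congr_ae (hS.mono fun ω hω => hω.tsum_eq)] at h
  refine h.unique ?_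
  convert! hasSum_zero using 1
  funext k
  rw [(ψ k).integral_comp_comm (hint _), h0, map_zero]

/-- The product of the two absolutely convergent series may be integrated termwise, because the `(j,
k)` term has L¹ norm at most `‖f‖ ‖ψ j‖ ‖ψ k‖ C`. The input enters the result only through its cross
covariances, so their shift invariance passes to the output. -/
theorem hasSum_crossCovOp_linear_filter (h0 : ∀ t, ∫ ω, W t ω ∂P = 0) {S T : Ω → E} {s t : ℤ}
    (hS : ∀ᵐ ω ∂P, Summable (fun k => ‖ψ k (W (s - k) ω)‖) ∧
      HasSum (fun k => ψ k (W (s - k) ω)) (S ω))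
    (hT : ∀ᵐ ω ∂P, Summable (fun k => ‖ψ k (W (t - k) ω)‖) ∧
      HasSum (fun k => ψ k (W (t - k) ω)) (T ω)) (f : StrongDual ℂ E) :
    HasSum (fun jk : ℤ × ℤ => ψ jk.2 (crossCovOp P (W (s - jk.1)) (W (t - jk.2)) (f ∘L ψ jk.1)))
      (crossCovOp P S T f) := by
  rw [crossCovOp_of_centered
    (integral_linear_filter_eq_zero hW hC hψ h0 (hS.mono fun _ h => h.2))
    (integral_linear_filter_eq_zero hW hC hψ h0 (hT.mono fun _ h => h.2))]
  simp only [crossCovOp_of_centered (h0 _) (h0 _)]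
  have hint : ∀ jk : ℤ × ℤ, Integrable (fun ω => (starRingEnd ℂ) (f (ψ jk.1 (W (s - jk.1) ω)))
      • ψ jk.2 (W (t - jk.2) ω)) P := fun jk =>
    ((hW _).continuousLinearMap_comp (ψ jk.1)).integrable_conj_smul
      ((hW _).continuousLinearMap_comp (ψ jk.2)) f
  have h := hasSum_integral_of_summable_integral_norm hint <| by
    refine Summable.of_nonneg_of_le (fun k => integral_nonneg fun ω => norm_nonneg _)
      (fun jk => ?_) (((hψ.mul_of_nonneg hψ (fun _ => norm_nonneg _)
        (fun _ => norm_nonneg _)).mul_left ‖f‖).mul_right C)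
    have hWW : Integrable (fun ω => ‖W (s - jk.1) ω‖ * ‖W (t - jk.2) ω‖) P :=
      (hW _).norm.integrable_mul (hW _).norm
    calc _ ≤ ∫ ω, ‖f‖ * (‖ψ jk.1‖ * ‖ψ jk.2‖) * (‖W (s - jk.1) ω‖ * ‖W (t - jk.2) ω‖) ∂P := by
          refine integral_mono (hint jk).norm (hWW.const_mul _) fun ω => ?_
          refine (norm_conj_smul_le f _ _).trans ?_
          calc _ ≤ ‖f‖ * ((‖ψ jk.1‖ * ‖W (s - jk.1) ω‖) * (‖ψ jk.2‖ * ‖W (t - jk.2) ω‖)) := by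
                gcongr <;> exact ContinuousLinearMap.le_opNorm _ _
            _ = _ := by ring
      _ ≤ _ := by
          rw [integral_const_mul]
          gcongr
          exact integral_norm_mul_norm_le (hW _) (hW _) (hC _) (hC _)
  convert! h using 1
  · funext jk
    rw [← (ψ jk.2).integral_comp_comm ((hW _).integrable_conj_smul (hW _) _)]
    simp only [map_smul, ContinuousLinearMap.comp_apply]
  · refine integral_congr_ae ?_
    filter_upwards [hS, hT] with ω h1 h2
    have hf : HasSum (fun j => (starRingEnd ℂ) (f (ψ j (W (s - j) ω))))
        ((starRingEnd ℂ) (f (S ω))) := Complex.hasSum_conj'.2 (f.hasSum h1.2)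
    refine (hf.smul h2.2 (Summable.of_norm_bounded ((h1.1.mul_of_nonneg h2.1
      (fun _ => norm_nonneg _) (fun _ => norm_nonneg _)).mul_left ‖f‖)
      fun jk => norm_conj_smul_le f _ _)).tsum_eq.symm

end Filters

/-! ### Weak control by the covariance operator -/

section WeakBound

variable {E : Type*} [NormedAddCommGroup E] [NormedSpace ℂ E] [CompleteSpace E]
  {Ω : Type*} [MeasurableSpace Ω] {P : Measure Ω} [IsProbabilityMeasure P]

/-- A centered `L²` random variable is controlled in the weak sense by its covariance operator. -/
theorem norm_setIntegral_le_of_crossCovOp_eq {X X₀ : Ω → E} (hX : MemLp X 2 P)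
    (hX₀ : MemLp X₀ 2 P) (hX' : ∫ ω, X ω ∂P = 0) (hX₀' : ∫ ω, X₀ ω ∂P = 0)
    (hcov : crossCovOp P X X = crossCovOp P X₀ X₀) (s : Set Ω) :
    ‖∫ ω in s, X ω ∂P‖ ≤ 1 + ∫ ω, ‖X₀ ω‖ ^ 2 ∂P := by
  -- A norming functional for the set integral reduces the bound to the scalar variable `f ∘ X`.
  obtain ⟨f, hf1, hfx⟩ := exists_dual_vector'' ℂ (∫ ω in s, X ω ∂P)
  have hint : Integrable X P := hX.integrable one_le_two
  have hfX : MemLp (fun ω => f (X ω)) 2 P := hX.continuousLinearMap_comp f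
  -- The covariance operator determines the scalar second moments through `f (C_V f) = 𝔼|f(V)|²`;
  -- this allows `X` to be exchanged for `X₀`.
  have hsq : ∀ {V : Ω → E}, MemLp V 2 P → ∫ ω, V ω ∂P = 0 →
      f (crossCovOp P V V f) = ((∫ ω, ‖f (V ω)‖ ^ 2 ∂P : ℝ) : ℂ) := by
    intro V hV hV'
    rw [crossCovOp_of_centered hV' hV', ← f.integral_comp_comm (hV.integrable_conj_smul hV f),
      ← integral_complex_ofReal]
    refine integral_congr_ae (Eventually.of_forall fun ω => ?_)
    simp only [map_smul, smul_eq_mul, Complex.ofReal_pow]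
    exact RCLike.conj_mul (f (V ω))
  have heq : ∫ ω, ‖f (X ω)‖ ^ 2 ∂P = ∫ ω, ‖f (X₀ ω)‖ ^ 2 ∂P := by
    have := hsq hX hX'
    rw [hcov, hsq hX₀ hX₀'] at this
    exact_mod_cast this.symm
  calc ‖∫ ω in s, X ω ∂P‖ = ‖∫ ω in s, f (X ω) ∂P‖ := by
        rw [f.integral_comp_comm hint.integrableOn, hfx]
        simp
    _ ≤ ∫ ω in s, ‖f (X ω)‖ ∂P := norm_integral_le_integral_norm _
    _ ≤ ∫ ω, ‖f (X ω)‖ ∂P := setIntegral_le_integral (f.integrable_comp hint).norm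
        (Eventually.of_forall fun ω => norm_nonneg _)
    _ ≤ 1 + ∫ ω, ‖f (X ω)‖ ^ 2 ∂P := integral_norm_le_one_add hfX
    _ ≤ 1 + ∫ ω, ‖X₀ ω‖ ^ 2 ∂P := by
        rw [heq]
        gcongr 1 + ?_
        refine integral_mono (hX₀.continuousLinearMap_comp f).norm.integrable_sq
          hX₀.norm.integrable_sq fun ω => ?_
        have := f.le_of_opNorm_le hf1 (X₀ ω)
        rw [one_mul] at this
        simp only
        gcongr

end WeakBound

/-! ### Weakly stationary processes and uniqueness -/

section Stationarity

variable {E : Type*} [NormedAddCommGroup E] [NormedSpace ℂ E] [MeasurableSpace E]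
  {Ω : Type*} [MeasurableSpace Ω] {P : Measure Ω}

theorem IsWeakWhiteNoise.crossCov_shift {Z : ℤ → Ω → E} (hZ : IsWeakWhiteNoise P Z)
    (s t h : ℤ) : crossCovOp P (Z (s + h)) (Z (t + h)) = crossCovOp P (Z s) (Z t) := by
  by_cases hst : s = t
  · rw [hst]
    exact hZ.cov_eq _ _
  · rw [hZ.crossCov_eq_zero _ _ hst, hZ.crossCov_eq_zero _ _ fun h' => hst (by omega)]

variable [CompleteSpace E] [IsProbabilityMeasure P]

/-- The set integrals of a weakly stationary process are bounded uniformly in time, even though its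
second moments `𝔼‖Y_t‖²` need not be. -/
theorem IsWeaklyStationary.exists_norm_setIntegral_le {Y : ℤ → Ω → E}
    (hY : IsWeaklyStationary P Y) : ∃ K : ℝ, ∀ t s, ‖∫ ω in s, Y t ω ∂P‖ ≤ K := by
  set m := ∫ ω, Y 0 ω ∂P with hm
  have hint : ∀ t, Integrable (Y t) P := fun t => (hY.memLp_two t).integrable one_le_two
  have hmean : ∀ t, ∫ ω, (Y t ω - m) ∂P = 0 := fun t => by
    rw [integral_sub (hint t) (integrable_const m), hY.mean_eq t 0]
    simp [hm]
  have hmem : ∀ t, MemLp (fun ω => Y t ω - m) 2 P := fun t =>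
    (hY.memLp_two t).sub (memLp_const m)
  have hcov : ∀ t, crossCovOp P (fun ω => Y t ω - m) (fun ω => Y t ω - m)
      = crossCovOp P (Y t) (Y t) := fun t => by
    funext f
    rw [crossCovOp_of_centered (hmean t) (hmean t), crossCovOp, hY.mean_eq t 0]
  refine ⟨1 + ∫ ω, ‖Y 0 ω - m‖ ^ 2 ∂P + ‖m‖, fun t s => ?_⟩
  have hcov' : crossCovOp P (Y t) (Y t) = crossCovOp P (Y 0) (Y 0) := by
    simpa using hY.crossCov_shift 0 0 t
  have h := norm_setIntegral_le_of_crossCovOp_eq (hmem t) (hmem 0) (hmean t) (hmean 0)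
    (by rw [hcov, hcov, hcov']) s
  have hsplit : ∫ ω in s, Y t ω ∂P = ∫ ω in s, (Y t ω - m) ∂P + P.real s • m := by
    rw [integral_sub (hint t).integrableOn (integrable_const m)]
    simp
  rw [hsplit]
  refine (norm_add_le _ _).trans (add_le_add h ?_)
  rw [norm_smul, Real.norm_of_nonneg measureReal_nonneg]
  exact mul_le_of_le_one_left (norm_nonneg _) measureReal_le_one

/-- Integrating over a fixed event commutes with the operators `A i` and cancels the common
right-hand side. The differences of set integrals then form a bounded homogeneous solution in `E`,
which is zero. -/
theorem IsARMASolution.ae_eq_of_isWeaklyStationary {p q : ℕ} {A B : ℕ → E →L[ℂ] E}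
    (hQ : ∀ z : ℂ, ‖z‖ = 1 → IsUnit (armaQ p A z)) {Z Y Y' : ℤ → Ω → E}
    (hY : IsARMASolution P p q A B Z Y) (hY' : IsARMASolution P p q A B Z Y')
    (hs : IsWeaklyStationary P Y) (hs' : IsWeaklyStationary P Y') (t : ℤ) : Y' t =ᵐ[P] Y t := by
  have hint : ∀ t, Integrable (Y t) P := fun t => (hs.memLp_two t).integrable one_le_two
  have hint' : ∀ t, Integrable (Y' t) P := fun t => (hs'.memLp_two t).integrable one_le_two
  obtain ⟨K, hK⟩ := hs.exists_norm_setIntegral_le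
  obtain ⟨K', hK'⟩ := hs'.exists_norm_setIntegral_le
  refine Integrable.ae_eq_of_forall_setIntegral_eq _ _ (hint' t) (hint t) fun s _ _ => ?_
  rw [← sub_eq_zero]
  refine eq_zero_of_bounded_of_homogeneous hQ
    (x := fun t => ∫ ω in s, Y' t ω ∂P - ∫ ω in s, Y t ω ∂P) (K := K' + K)
    (fun t => (norm_sub_le _ _).trans (add_le_add (hK' t s) (hK t s))) (fun t => ?_) t
  have hset : ∀ {V : ℤ → Ω → E}, (∀ t, Integrable (V t) P) →
      ∫ ω in s, (V t ω - ∑ i ∈ Finset.Icc 1 p, A i (V (t - i) ω)) ∂P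
        = ∫ ω in s, V t ω ∂P - ∑ i ∈ Finset.Icc 1 p, A i (∫ ω in s, V (t - i) ω ∂P) := by
    intro V hV
    have hAV : ∀ i : ℕ, Integrable (fun ω => A i (V (t - i) ω)) (P.restrict s) := fun i =>
      ((A i).integrable_comp (hV _)).integrableOn
    rw [integral_sub (hV t).integrableOn (integrable_finsetSum _ fun i _ => hAV i),
      integral_finsetSum _ fun i _ => hAV i]
    congr 1
    exact Finset.sum_congr rfl fun i _ => (A i).integral_comp_comm (hV _).integrableOn
  have h : ∫ ω in s, (Y' t ω - ∑ i ∈ Finset.Icc 1 p, A i (Y' (t - i) ω)) ∂P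
      = ∫ ω in s, (Y t ω - ∑ i ∈ Finset.Icc 1 p, A i (Y (t - i) ω)) ∂P := by
    refine integral_congr_ae (ae_restrict_of_ae ?_)
    filter_upwards [hY t, hY' t] with ω h1 h2
    rw [h1, h2]
  rw [hset hint', hset hint, ← sub_eq_zero] at h
  simp only [map_sub, Finset.sum_sub_distrib]
  rw [← h]
  abel

end Stationarity

/-! ### The Laurent expansion and the unique stationary solution -/

theorem corollary2 {E : Type*} [NormedAddCommGroup E] [NormedSpace ℂ E] [CompleteSpace E]
    [TopologicalSpace.SeparableSpace E] [MeasurableSpace E] [BorelSpace E]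
    {Ω : Type*} [MeasurableSpace Ω] (P : Measure Ω) [IsProbabilityMeasure P]
    (p q : ℕ) (A B : ℕ → E →L[ℂ] E)
    (hQ : ∀ z : ℂ, ‖z‖ = 1 → IsUnit (armaQ p A z))
    (Z : ℤ → Ω → E) (hZ : IsWeakWhiteNoise P Z) (hZ0 : ∫ ω, Z 0 ω ∂P = 0)
    (hZbdd : ∃ C : ℝ, ∀ t, ∫ ω, ‖Z t ω‖ ^ 2 ∂P ≤ C) :
    -- `ψ` is the sequence of Laurent coefficients on an annulus around the unit circle
    (∃ r R : ℝ, 0 < r ∧ r < 1 ∧ 1 < R ∧ ∀ z : ℂ, r < ‖z‖ → ‖z‖ < R →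
      IsUnit (arPoly p A z) ∧
      HasSum (fun k : ℤ => z ^ k • armaCoeff p q A B k) (armaTransfer p q A B z)) ∧
    ∃ Y : ℤ → Ω → E,
      IsWeaklyStationary P Y ∧ IsARMASolution P p q A B Z Y ∧
      -- uniqueness up to modification
      (∀ Y' : ℤ → Ω → E, IsWeaklyStationary P Y' → IsARMASolution P p q A B Z Y' →
        ∀ t, Y' t =ᵐ[P] Y t) ∧
      -- almost surely absolutely convergent series
      (∀ t, ∀ᵐ ω ∂P, Summable (fun k : ℤ => ‖armaCoeff p q A B k (Z (t - k) ω)‖) ∧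
        HasSum (fun k : ℤ => armaCoeff p q A B k (Z (t - k) ω)) (Y t ω)) ∧
      -- convergence of the series in `L²`
      (∀ t, Tendsto (fun s : Finset ℤ =>
          eLpNorm (fun ω => Y t ω - ∑ k ∈ s, armaCoeff p q A B k (Z (t - k) ω)) 2 P)
        atTop (𝓝 0)) := by
  obtain ⟨C, hC⟩ := hZbdd
  have hψ := summable_norm_armaCoeff hQ q B
  have h0 : ∀ t, ∫ ω, Z t ω ∂P = 0 := fun t => (hZ.mean_eq t 0).trans hZ0
  refine ⟨?_, ?_⟩
  · obtain ⟨r, R, hr, hr1, hR, h⟩ := exists_annulus_isUnit_arPoly hQ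
    exact ⟨r, R, hr, hr1, hR, fun z hz hz' => ⟨h z hz hz', hasSum_laurent hr hr1 hR
      (differentiableOn_armaTransfer (fun w hw => h w hw.1 hw.2) q B) hz hz'⟩⟩
  · choose Y hYm hY2 hYs hYL using exists_linear_filter hZ.memLp_two hC hψ
    have hYmean : ∀ t, ∫ ω, Y t ω ∂P = 0 := fun t =>
      integral_linear_filter_eq_zero hZ.memLp_two hC hψ h0 ((hYs t).mono fun _ h => h.2)
    have hYstat : IsWeaklyStationary P Y := by
      refine ⟨fun t => (hYm t).measurable, hY2, fun s t => by rw [hYmean, hYmean], ?_⟩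
      intro s t h
      funext f
      have h1 := hasSum_crossCovOp_linear_filter hZ.memLp_two hC hψ h0
        (hYs (s + h)) (hYs (t + h)) f
      have h2 := hasSum_crossCovOp_linear_filter hZ.memLp_two hC hψ h0 (hYs s) (hYs t) f
      -- Rewriting `s + h - j` as `s - j + h` exposes a common shift of both noise indices, so the
      -- two double series agree term by term.
      simp only [add_sub_right_comm, hZ.crossCov_shift] at h1
      exact h1.unique h2
    have hYsol : IsARMASolution P p q A B Z Y := by
      intro t
      -- Countability of `ℤ` gives one null set outside which all the series converge, so the
      -- deterministic identity applies path by path.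
      filter_upwards [ae_all_iff.2 hYs] with ω hω
      exact armaSeries_sub_sum hQ q B (z := fun t => Z t ω) (y := fun t => Y t ω)
        (fun t => (hω t).2) t
    exact ⟨Y, hYstat, hYsol, fun Y' hY' hsol =>
      hYsol.ae_eq_of_isWeaklyStationary hQ hsol hYstat hY', hYs, hYL⟩
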